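/- Let $n\ge 1$ and let $\mathcal A,\mathcal B$ be nonempty compact metric spaces. Let $f^{\alpha,\beta},c^{\alpha,\beta},a^{\alpha,\beta}:\mathbb R^n\to\mathbb R$ and $b^{\alpha,\beta}:\mathbb R^n\to\mathbb R^n$ ($\alpha\in\mathcal A$, $\beta\in\mathcal B$) be continuous in $(\alpha,\beta,x)$, and suppose that there are constants $K\ge 0$, $\lambda>0$, $\lambda_1>0$ such that for all $(\alpha,\beta)$ and $x$ $$|a^{\alpha,\beta}|_{C^{0,1}}+|b^{\alpha,\beta}|_{C^{0,1}}+|c^{\alpha,\beta}|_{C^{0,1}}+|f^{\alpha,\beta}|_{C^{0,1}}\le K,\qquad c^{\alpha,\beta}(x)>\lambda,\qquad a^{\alpha,\beta}(x)>\lambda_1,$$ where $|g|_{C^{0,1}}=\sup_x|g(x)|+\sup_{x\ne y}\frac{|g(x)-g(y)|}{|x-y|}$. Put $$F(x,r,p,t)=\sup_{\alpha\in\mathcal A}\inf_{\beta\in\mathcal B}\big\{f^{\alpha,\beta}(x)+c^{\alpha,\beta}(x)r+b^{\alpha,\beta}(x)\cdot p+a^{\alpha,\beta}(x)t\big\}.$$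 Viscosity sense. Let $c_n=\Gamma(\frac{n+1}2)\,\pi^{-\frac{n+1}2}$ and, for $\kappa\in(0,1)$, $$\mathcal I_\kappa\varphi(x)=-c_n\,\mathrm{p.v.}\!\int_{|z|<\kappa}\frac{\varphi(x+z)-\varphi(x)}{|z|^{n+1}}\,dz,\qquad \mathcal I^\kappa w(x)=-c_n\int_{|z|\ge\kappa}\frac{w(x+z)-w(x)}{|z|^{n+1}}\,dz .$$ For $G:\mathbb R^n\times\mathbb R\times\mathbb R^n\times\mathbb R\to\mathbb R$, a bounded upper semicontinuous function $w$ on $\mathbb R^n$ satisfies $G(x,w,\nabla w,(-\Delta)^{1/2}w)\le 0$ in the viscosity sense if, whenever $\varphi\in C^2(\mathbb R^n)$ and $x$ is a global maximum point of $w-\varphi$, one has $G\big(x,w(x),\nabla\varphi(x),\mathcal I_\kappa\varphi(x)+\mathcal I^\kappa w(x)\big)\le 0$ for all $\kappa\in(0,1)$. The inequality $\ge 0$ is defined symmetrically, for bounded lower semicontinuous $w$ and global minimum points. A viscosity solution of $G=0$ satisfies both. 1. For all $M,L\ge 0$ there are constants $A,B_0,B_1>0$ such that for every $\ell\in\mathbb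 R^n$ (so the constants do not depend on $\ell$) and all $u,v:\mathbb R^n\to\mathbb R$ that are bounded by $M$ in absolute value and Lipschitz continuous with constant $L$, the following holds. (a) If in the viscosity sense $F(x+\ell,u,\nabla u,(-\Delta)^{1/2}u)\le 0$ and $F(x,v,\nabla v,(-\Delta)^{1/2}v)\ge 0$, then in the viscosity sense $$-B_0\sup_{x\in\mathbb R^n}|u(x+\ell)-v(x)|-A|\nabla(u-v)|-B_1|\ell|+\lambda(u-v)+(-\Delta)^{1/2}(u-v)\le 0 .$$ (b) If in the viscosity sense $F(x+\ell,u,\nabla u,(-\Delta)^{1/2}u)\ge 0$ and $F(x,v,\nabla v,(-\Delta)^{1/2}v)\le 0$, then in the viscosity sense $$B_0\sup_{x\in\mathbb R^n}|u(x+\ell)-v(x)|+A|\nabla(u-v)|+B_1|\ell|+\lambda(u-v)+(-\Delta)^{1/2}(u-v)\ge 0 .$$ 2. If $u$ is a Lipschitz continuous viscosity solution of $F(x,u,\nabla u,(-\Delta)^{1/2}u)=0$, then there are constants $A,B>0$ such that for every $\ell\in\mathbb R^n$ the function $v(x)=u(x+\ell)-u(x)$ satisfies, in the viscosity sense, $$-A|\nabla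 v|-B|\ell|+\lambda v+(-\Delta)^{1/2}v\le 0\qquad\text{and}\qquad A|\nabla v|+B|\ell|+\lambda v+(-\Delta)^{1/2}v\ge 0 .$$ -/

import Mathlib

open MeasureTheory Filter Topology
open scoped NNReal ENNReal

noncomputable section

/-- The Euclidean space `ℝⁿ`. -/
abbrev Rn (n : ℕ) : Type := EuclideanSpace ℝ (Fin n)

/-- The normalising constant `c(n, 1/2) = Γ((n+1)/2) / π^((n+1)/2)` of the half-Laplacian. -/
def halfLapConst (n : ℕ) : ℝ :=
  Real.Gamma (((n : ℝ) + 1) / 2) / Real.pi ^ (((n : ℝ) + 1) / 2)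

/-- The singular part of the half-Laplacian,
`-c(n,1/2) p.v. ∫_{|z| < κ} (φ(x+z) - φ(x)) / |z|^(n+1) dz`. The integral is a principal value
(limit of the integrals over `ε ≤ |z| < κ` as `ε ↓ 0`), which converges for every `φ` of class
`C²`. -/
def innerHalfLap {n : ℕ} (κ : ℝ) (φ : Rn n → ℝ) (x : Rn n) : ℝ :=
  -halfLapConst n * limUnder (𝓝[>] (0 : ℝ)) (fun ε : ℝ =>
    ∫ z in Metric.ball (0 : Rn n) κ \ Metric.ball (0 : Rn n) ε,
      (φ (x + z) - φ x) / ‖z‖ ^ (n + 1))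

/-- The nonsingular part of the half-Laplacian,
`-c(n,1/2) ∫_{|z| ≥ κ} (u(x+z) - u(x)) / |z|^(n+1) dz`; the integrand is integrable for `κ > 0`
and `u` bounded and measurable. -/
def outerHalfLap {n : ℕ} (κ : ℝ) (u : Rn n → ℝ) (x : Rn n) : ℝ :=
  -halfLapConst n * ∫ z in (Metric.ball (0 : Rn n) κ)ᶜ, (u (x + z) - u x) / ‖z‖ ^ (n + 1)

/-- `u` satisfies `F(x, u, ∇u, (-Δ)^{1/2} u) ≤ 0` on `ℝⁿ` in the viscosity sense. -/
def IsViscositySubsolution {n : ℕ} (F : Rn n → ℝ → Rn n → ℝ → ℝ) (u : Rn n → ℝ) : Prop :=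
  UpperSemicontinuous u ∧ (∃ C : ℝ, ∀ x, |u x| ≤ C) ∧
  ∀ φ : Rn n → ℝ, ContDiff ℝ 2 φ → ∀ x : Rn n, (∀ y, u y - φ y ≤ u x - φ x) →
    ∀ κ ∈ Set.Ioo (0 : ℝ) 1,
      F x (u x) (gradient φ x) (innerHalfLap κ φ x + outerHalfLap κ u x) ≤ 0

/-- `u` satisfies `F(x, u, ∇u, (-Δ)^{1/2} u) ≥ 0` on `ℝⁿ` in the viscosity sense. -/
def IsViscositySupersolution {n : ℕ} (F : Rn n → ℝ → Rn n → ℝ → ℝ) (u : Rn n → ℝ) : Prop :=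
  LowerSemicontinuous u ∧ (∃ C : ℝ, ∀ x, |u x| ≤ C) ∧
  ∀ φ : Rn n → ℝ, ContDiff ℝ 2 φ → ∀ x : Rn n, (∀ y, u x - φ x ≤ u y - φ y) →
    ∀ κ ∈ Set.Ioo (0 : ℝ) 1,
      0 ≤ F x (u x) (gradient φ x) (innerHalfLap κ φ x + outerHalfLap κ u x)

/-- Viscosity solutions; being both upper and lower semicontinuous and bounded, they are
in `C_b(ℝⁿ)`. -/
def IsViscositySolution {n : ℕ} (F : Rn n → ℝ → Rn n → ℝ → ℝ) (u : Rn n → ℝ) : Prop :=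
  IsViscositySubsolution F u ∧ IsViscositySupersolution F u

/-- The norm `|g|_{C^{0,1}(ℝⁿ)} = sup |g| + sup |g(x) - g(y)| / |x - y|`, with values in `[0, ∞]`
(the terms with `x = y` are `0 / 0 = 0`). -/
def lipNorm {n : ℕ} {V : Type*} [NormedAddCommGroup V] (g : Rn n → V) : ℝ≥0∞ :=
  (⨆ x, ‖g x‖ₑ) + ⨆ x, ⨆ y, ‖g x - g y‖ₑ / ‖x - y‖ₑ

/-- The coefficients of an Isaacs operator. -/
structure IsaacsCoeff (n : ℕ) (𝒜 ℬ : Type*) where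
  f : 𝒜 → ℬ → Rn n → ℝ
  c : 𝒜 → ℬ → Rn n → ℝ
  b : 𝒜 → ℬ → Rn n → Rn n
  a : 𝒜 → ℬ → Rn n → ℝ

namespace IsaacsCoeff

/-- `F(x, r, p, t) = sup_α inf_β { f(x) + c(x) r + b(x) · p + a(x) t }`. -/
def op {n : ℕ} {𝒜 ℬ : Type*} (D : IsaacsCoeff n 𝒜 ℬ) (x : Rn n) (r : ℝ) (p : Rn n) (t : ℝ) : ℝ :=
  ⨆ α : 𝒜, ⨅ β : ℬ, (D.f α β x + D.c α β x * r + inner ℝ (D.b α β x) p + D.a α β x * t)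

/-- The operator with coefficients shifted by `ℓ`: `F(x + ℓ, r, p, t)`. -/
def shiftedOp {n : ℕ} {𝒜 ℬ : Type*} (D : IsaacsCoeff n 𝒜 ℬ) (ℓ : Rn n)
    (x : Rn n) (r : ℝ) (p : Rn n) (t : ℝ) : ℝ :=
  D.op (x + ℓ) r p t

/-- The standing assumptions on the coefficients (the compactness of the metric spaces `𝒜`, `ℬ`
is expressed by type classes), with `lam` the lower bound of the zeroth order coefficient. -/
structure Admissible {n : ℕ} {𝒜 ℬ : Type*} [MetricSpace 𝒜] [MetricSpace ℬ]
    (D : IsaacsCoeff n 𝒜 ℬ) (lam : ℝ) : Prop where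
  continuous_f : Continuous fun q : 𝒜 × ℬ × Rn n => D.f q.1 q.2.1 q.2.2
  continuous_c : Continuous fun q : 𝒜 × ℬ × Rn n => D.c q.1 q.2.1 q.2.2
  continuous_b : Continuous fun q : 𝒜 × ℬ × Rn n => D.b q.1 q.2.1 q.2.2
  continuous_a : Continuous fun q : 𝒜 × ℬ × Rn n => D.a q.1 q.2.1 q.2.2
  bounded_lipschitz : ∃ K : ℝ≥0, ∀ α β,
    lipNorm (D.a α β) + lipNorm (D.b α β) + lipNorm (D.c α β) + lipNorm (D.f α β) ≤ (K : ℝ≥0∞)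
  lam_pos : 0 < lam
  lam_lt_c : ∀ α β x, lam < D.c α β x
  elliptic : ∃ lam₁ : ℝ, 0 < lam₁ ∧ ∀ α β x, lam₁ < D.a α β x

end IsaacsCoeff

/-- The operator `-A |∇w| - B + λ w + (-Δ)^{1/2} w`. -/
def lowerExtremal {n : ℕ} (A B lam : ℝ) (_x : Rn n) (r : ℝ) (p : Rn n) (t : ℝ) : ℝ :=
  -A * ‖p‖ - B + lam * r + t

/-- The operator `A |∇w| + B + λ w + (-Δ)^{1/2} w`. -/
def upperExtremal {n : ℕ} (A B lam : ℝ) (_x : Rn n) (r : ℝ) (p : Rn n) (t : ℝ) : ℝ :=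
  A * ‖p‖ + B + lam * r + t

end

/-!
The proof doubles the variables. At a maximum point `x₀` of `u - v - φ` one maximizes
`u(x) - v(y) - φ(x) - δ |x - x₀|² - δ⁻² |x - y|²` (`exists_doubling_max`). As `v` is Lipschitz, the
maximum point `(x, y)` satisfies `|x - y| ≤ L δ²`, so the gradient `2 δ⁻² (x - y)` that the
penalization contributes to both test functions is bounded by `2 L`.

The nonlocal terms are treated with a radius `ε` far smaller than `δ²`. Inside `|z| < ε` the
penalization contributes a negligible amount. On the annulus `ε ≤ |z| < κ` the maximum property,
applied to the points `(x + z, y + z)`, bounds the increments of `u - v` by those of the test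
function, since the penalization in `x - y` does not see a common translation
(`outerHalfLap_sub_ge`). On `|z| ≥ κ` the terms are continuous in the point. Letting `δ → 0` requires
that the principal value of a `C²` function is continuous in the point; this follows from its
absolutely convergent form, in which the first order Taylor term is subtracted
(`innerHalfLap_eq`, `tendsto_taylorIntegral`).

On the side of the operator, `F(x, r, p, t) ≤ 0 ≤ F(y, s, q, τ)` gives a pair `(α, β)` for which the
corresponding affine functions satisfy both inequalities up to a small error. Dividing them by the
elliptic coefficient `a` bounds `t - τ` from above by `|x - y|`, `|r - s|` and `|p - q|`
(`IsaacsCoeff.Bounds.sub_le`), although `t` and `τ` themselves are not controlled. The constants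
`A`, `B₀` and `B₁` are read off from this bound. The inequality `≥ 0` follows by exchanging `u` and
`v` and changing the sign, and the statement on `u(x+ℓ) - u(x)` follows since the translate of `u`
solves the shifted equation and differs from `u` by at most `L |ℓ|`.
-/

/-! ### Comparison of two values of an Isaacs operator -/

theorem norm_le_of_lipNorm_le {n : ℕ} {V : Type*} [NormedAddCommGroup V] {g : Rn n → V}
    {K : ℝ≥0} (h : lipNorm g ≤ K) (x : Rn n) : ‖g x‖ ≤ K := by
  have h1 : ‖g x‖ₑ ≤ (K : ℝ≥0∞) :=
    (le_iSup (fun x => ‖g x‖ₑ) x).trans (le_self_add.trans h)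
  exact enorm_le_coe.1 h1

theorem norm_sub_le_of_lipNorm_le {n : ℕ} {V : Type*} [NormedAddCommGroup V] {g : Rn n → V}
    {K : ℝ≥0} (h : lipNorm g ≤ K) (x y : Rn n) : ‖g x - g y‖ ≤ K * ‖x - y‖ := by
  rcases eq_or_ne x y with rfl | hxy
  · simp
  have h1 : ‖g x - g y‖ₑ / ‖x - y‖ₑ ≤ (K : ℝ≥0∞) :=
    (le_iSup₂ (f := fun x y => ‖g x - g y‖ₑ / ‖x - y‖ₑ) x y).trans (le_add_self.trans h)
  have h0 : ‖x - y‖ₑ ≠ 0 := by simpa [sub_eq_zero] using hxy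
  rw [ENNReal.div_le_iff h0 enorm_ne_top] at h1
  have h2 : ‖g x - g y‖ₑ ≤ ((K * ‖x - y‖₊ : ℝ≥0) : ℝ≥0∞) := by
    rw [ENNReal.coe_mul]; exact h1
  exact_mod_cast enorm_le_coe.1 h2

namespace IsaacsCoeff

/-- The affine function of `(r, p, t)` with index `(α, β)` in the Isaacs operator. -/
noncomputable def lin {n : ℕ} {𝒜 ℬ : Type*} (D : IsaacsCoeff n 𝒜 ℬ) (α : 𝒜) (β : ℬ) (x : Rn n) (r : ℝ)
    (p : Rn n) (t : ℝ) : ℝ :=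
  D.f α β x + D.c α β x * r + inner ℝ (D.b α β x) p + D.a α β x * t

/-- Bounds on the coefficients, in the form in which they enter the comparison of two values of the
operator: `K` bounds the size and the Lipschitz constants, `lam₁` is the ellipticity constant. -/
structure Bounds {n : ℕ} {𝒜 ℬ : Type*} (D : IsaacsCoeff n 𝒜 ℬ) (K lam₁ : ℝ) : Prop where
  nonneg : 0 ≤ K
  pos : 0 < lam₁
  a_gt : ∀ α β x, lam₁ < D.a α β x
  f_le : ∀ α β x, |D.f α β x| ≤ K
  c_le : ∀ α β x, |D.c α β x| ≤ K
  b_le : ∀ α β x, ‖D.b α β x‖ ≤ K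
  a_le : ∀ α β x, |D.a α β x| ≤ K
  f_sub : ∀ α β x y, |D.f α β x - D.f α β y| ≤ K * ‖x - y‖
  c_sub : ∀ α β x y, |D.c α β x - D.c α β y| ≤ K * ‖x - y‖
  b_sub : ∀ α β x y, ‖D.b α β x - D.b α β y‖ ≤ K * ‖x - y‖
  a_sub : ∀ α β x y, |D.a α β x - D.a α β y| ≤ K * ‖x - y‖

variable {n : ℕ} {𝒜 ℬ : Type*} {D : IsaacsCoeff n 𝒜 ℬ}

theorem Admissible.exists_bounds [MetricSpace 𝒜] [MetricSpace ℬ] {lam : ℝ}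
    (hD : D.Admissible lam) : ∃ K lam₁ : ℝ, D.Bounds K lam₁ := by
  obtain ⟨K, hK⟩ := hD.bounded_lipschitz
  obtain ⟨lam₁, h0, h1⟩ := hD.elliptic
  have ha : ∀ α β, lipNorm (D.a α β) ≤ K := fun α β =>
    (le_self_add.trans (le_self_add.trans le_self_add)).trans (hK α β)
  have hb : ∀ α β, lipNorm (D.b α β) ≤ K := fun α β =>
    (le_add_self.trans (le_self_add.trans le_self_add)).trans (hK α β)
  have hc : ∀ α β, lipNorm (D.c α β) ≤ K := fun α β =>
    (le_add_self.trans le_self_add).trans (hK α β)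
  have hf : ∀ α β, lipNorm (D.f α β) ≤ K := fun α β => le_add_self.trans (hK α β)
  exact ⟨K, lam₁, K.2, h0, h1,
    fun α β x => norm_le_of_lipNorm_le (hf α β) x, fun α β x => norm_le_of_lipNorm_le (hc α β) x,
    fun α β x => norm_le_of_lipNorm_le (hb α β) x, fun α β x => norm_le_of_lipNorm_le (ha α β) x,
    fun α β x y => norm_sub_le_of_lipNorm_le (hf α β) x y,
    fun α β x y => norm_sub_le_of_lipNorm_le (hc α β) x y,
    fun α β x y => norm_sub_le_of_lipNorm_le (hb α β) x y,
    fun α β x y => norm_sub_le_of_lipNorm_le (ha α β) x y⟩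

variable {K lam₁ : ℝ}

theorem Bounds.abs_lin_le (h : D.Bounds K lam₁) (α : 𝒜) (β : ℬ) (x : Rn n) (r : ℝ) (p : Rn n)
    (t : ℝ) : |D.lin α β x r p t| ≤ K + K * |r| + K * ‖p‖ + K * |t| := by
  unfold lin
  refine (abs_add_le _ _).trans (add_le_add ((abs_add_le _ _).trans (add_le_add
    ((abs_add_le _ _).trans (add_le_add (h.f_le α β x) ?_)) ?_)) ?_)
  · rw [abs_mul]; gcongr; exact h.c_le α β x
  · refine (abs_real_inner_le_norm _ _).trans ?_
    gcongr; exact h.b_le α β x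
  · rw [abs_mul]; gcongr; exact h.a_le α β x

/-- If the operator is nonpositive at one point and nonnegative at another one, then a single pair
`(α, β)` witnesses both inequalities up to an arbitrarily small error. -/
theorem Bounds.exists_index [Nonempty 𝒜] [Nonempty ℬ] (h : D.Bounds K lam₁) {x y : Rn n}
    {r s t τ : ℝ} {p q : Rn n} (h1 : D.op x r p t ≤ 0) (h2 : 0 ≤ D.op y s q τ) {δ : ℝ}
    (hδ : 0 < δ) : ∃ α β, D.lin α β x r p t < δ ∧ -δ < D.lin α β y s q τ := by
  have hbelow : ∀ α (x : Rn n) (r : ℝ) (p : Rn n) (t : ℝ),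
      BddBelow (Set.range fun β => D.lin α β x r p t) := fun α x r p t =>
    ⟨-(K + K * |r| + K * ‖p‖ + K * |t|), by
      rintro _ ⟨β, rfl⟩; exact (abs_le.1 (h.abs_lin_le α β x r p t)).1⟩
  obtain ⟨α, hα⟩ : ∃ α, -δ < ⨅ β, D.lin α β y s q τ :=
    exists_lt_of_lt_ciSup (lt_of_lt_of_le (neg_lt_zero.2 hδ) h2)
  have habove : BddAbove (Set.range fun α => ⨅ β, D.lin α β x r p t) :=
    ⟨K + K * |r| + K * ‖p‖ + K * |t|, by
      rintro _ ⟨α, rfl⟩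
      obtain ⟨β⟩ := ‹Nonempty ℬ›
      exact (ciInf_le (hbelow α x r p t) β).trans (abs_le.1 (h.abs_lin_le α β x r p t)).2⟩
  have hx : ⨅ β, D.lin α β x r p t < δ := ((le_ciSup habove α).trans h1).trans_lt hδ
  obtain ⟨β, hβ⟩ := exists_lt_of_ciInf_lt hx
  exact ⟨α, β, hβ, hα.trans_le (ciInf_le (hbelow α y s q τ) β)⟩

/-- The comparison of the nonlocal arguments `t`, `τ`. Dividing by the elliptic coefficient `a`
isolates them, so no bound on `t` or `τ` enters the right-hand side. -/
theorem Bounds.sub_le [Nonempty 𝒜] [Nonempty ℬ] (h : D.Bounds K lam₁) {x y : Rn n}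
    {r s t τ : ℝ} {p q : Rn n} (h1 : D.op x r p t ≤ 0) (h2 : 0 ≤ D.op y s q τ) :
    t - τ ≤ (K / lam₁ + K ^ 2 / lam₁ ^ 2) * (1 + |s| + ‖q‖) * ‖x - y‖ + K / lam₁ * |r - s|
      + K / lam₁ * ‖p - q‖ := by
  have hK := h.nonneg
  have hl := h.pos
  refine le_of_forall_pos_le_add fun ε hε => ?_
  obtain ⟨α, β, hx, hy⟩ := h.exists_index h1 h2 (δ := lam₁ * ε / 2) (by positivity)
  unfold lin at hx hy
  have ha := h.a_gt α β x
  have ha' := h.a_gt α β y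
  have hda := h.a_sub α β x y
  have hfy := h.f_le α β y
  have hcy := h.c_le α β y
  have hcx := h.c_le α β x
  have hby := h.b_le α β y
  have hbx := h.b_le α β x
  have hdf := h.f_sub α β x y
  have hdc := h.c_sub α β x y
  have hdb := h.b_sub α β x y
  have hinner : inner ℝ (D.b α β y) q - inner ℝ (D.b α β x) p
      = -inner ℝ (D.b α β x - D.b α β y) q - inner ℝ (D.b α β x) (p - q) := by
    rw [inner_sub_left, inner_sub_right]; ring
  have hi1 : |inner ℝ (D.b α β x - D.b α β y) q| ≤ K * ‖x - y‖ * ‖q‖ :=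
    (abs_real_inner_le_norm _ _).trans (by gcongr)
  have hi2 : |inner ℝ (D.b α β x) (p - q)| ≤ K * ‖p - q‖ :=
    (abs_real_inner_le_norm _ _).trans (by gcongr)
  have hi3 : |inner ℝ (D.b α β y) q| ≤ K * ‖q‖ :=
    (abs_real_inner_le_norm _ _).trans (by gcongr)
  have hc1 : |(D.c α β x - D.c α β y) * s| ≤ K * ‖x - y‖ * |s| := by
    rw [abs_mul]; gcongr
  have hc2 : |D.c α β x * (r - s)| ≤ K * |r - s| := by
    rw [abs_mul]; gcongr
  have hc3 : |D.c α β y * s| ≤ K * |s| := by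
    rw [abs_mul]; gcongr
  generalize D.a α β x = a at *
  generalize D.a α β y = a' at *
  have ha0 : 0 < a := hl.trans ha
  have ha0' : 0 < a' := hl.trans ha'
  -- `e` and `e'` are the parts of the affine functions that do not involve `t` and `τ`.
  set e := D.f α β x + D.c α β x * r + inner ℝ (D.b α β x) p with he
  set e' := D.f α β y + D.c α β y * s + inner ℝ (D.b α β y) q with he'
  have h3 : |e'| ≤ K * (1 + |s| + ‖q‖) := by
    rw [abs_le] at *; constructor <;> linarith
  have h4 : e' - e ≤ K * (1 + |s| + ‖q‖) * ‖x - y‖ + K * |r - s| + K * ‖p - q‖ := by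
    rw [abs_le] at hdf hi1 hi2 hc1 hc2
    have : e' - e = -(D.f α β x - D.f α β y) - (D.c α β x - D.c α β y) * s
      - D.c α β x * (r - s) - inner ℝ (D.b α β x - D.b α β y) q
      - inner ℝ (D.b α β x) (p - q) := by rw [he, he']; linarith [hinner]
    rw [this]; linarith
  have h5 : t < (lam₁ * ε / 2 - e) / a := by rw [lt_div_iff₀ ha0]; linarith
  have h6 : (-(lam₁ * ε / 2) - e') / a' < τ := by rw [div_lt_iff₀ ha0']; linarith
  have h7 : (lam₁ * ε / 2) / a ≤ ε / 2 := by
    rw [div_le_iff₀ ha0]; nlinarith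
  have h8 : (lam₁ * ε / 2) / a' ≤ ε / 2 := by
    rw [div_le_iff₀ ha0']; nlinarith
  have h9 : (e' - e) / a ≤
      (K * (1 + |s| + ‖q‖) * ‖x - y‖ + K * |r - s| + K * ‖p - q‖) / lam₁ :=
    (div_le_div_of_nonneg_right h4 ha0.le).trans
      (div_le_div_of_nonneg_left (by positivity) hl ha.le)
  have h10 : e' * ((a - a') / (a * a')) ≤
      K * (1 + |s| + ‖q‖) * (K * ‖x - y‖ / (lam₁ * lam₁)) := by
    refine (le_abs_self _).trans ?_
    rw [abs_mul, abs_div, abs_of_pos (mul_pos ha0 ha0')]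
    gcongr
  have h11 : e' / a' - e / a = (e' - e) / a + e' * ((a - a') / (a * a')) := by
    field_simp; ring
  have h12 : (lam₁ * ε / 2 - e) / a - (-(lam₁ * ε / 2) - e') / a'
      = (lam₁ * ε / 2) / a + (lam₁ * ε / 2) / a' + (e' / a' - e / a) := by ring
  have h13 : (K * (1 + |s| + ‖q‖) * ‖x - y‖ + K * |r - s| + K * ‖p - q‖) / lam₁
      + K * (1 + |s| + ‖q‖) * (K * ‖x - y‖ / (lam₁ * lam₁))
      = (K / lam₁ + K ^ 2 / lam₁ ^ 2) * (1 + |s| + ‖q‖) * ‖x - y‖ + K / lam₁ * |r - s|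
      + K / lam₁ * ‖p - q‖ := by field_simp; ring
  linarith

end IsaacsCoeff

/-! ### The singular and the nonsingular part of the half-Laplacian -/

section Integrals

variable {n : ℕ}

theorem integrableOn_ball_sq_div (hn : 1 ≤ n) (κ : ℝ) :
    IntegrableOn (fun z : Rn n => ‖z‖ ^ 2 / ‖z‖ ^ (n + 1)) (Metric.ball 0 κ) := by
  have : Nontrivial (Rn n) := by
    have : Nonempty (Fin n) := ⟨⟨0, hn⟩⟩
    infer_instance
  rw [integrableOn_fun_norm_addHaar (volume : Measure (Rn n)) (f := fun r => r ^ 2 / r ^ (n + 1))]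
  have h : IntegrableOn (fun _ : ℝ => (1 : ℝ)) (Set.Ioo 0 κ) := by simp
  refine h.congr_fun (fun r hr => ?_) measurableSet_Ioo
  have hr0 : r ≠ 0 := hr.1.ne'
  simp only [finrank_euclideanSpace, Fintype.card_fin, smul_eq_mul]
  obtain ⟨m, rfl⟩ : ∃ m, n = m + 1 := ⟨n - 1, by omega⟩
  simp only [Nat.add_sub_cancel]
  field_simp
  ring

theorem integrableOn_compl_ball_kernel (hn : 1 ≤ n) {κ : ℝ} (hκ : 0 < κ) :
    IntegrableOn (fun z : Rn n => 1 / ‖z‖ ^ (n + 1)) (Metric.ball 0 κ)ᶜ := by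
  have : Nontrivial (Rn n) := by
    have : Nonempty (Fin n) := ⟨⟨0, hn⟩⟩
    infer_instance
  rw [← integrable_indicator_iff Metric.isOpen_ball.measurableSet.compl]
  have h : Integrable (fun z : Rn n => (Set.Ici κ).indicator (fun r => 1 / r ^ (n + 1)) ‖z‖) := by
    rw [integrable_fun_norm_addHaar (volume : Measure (Rn n))
      (f := (Set.Ici κ).indicator fun r => 1 / r ^ (n + 1))]
    have h2 : IntegrableOn (fun r : ℝ => r ^ (-2 : ℝ)) (Set.Ici κ) :=
      (integrableOn_Ici_iff_integrableOn_Ioi (by simp)).2 (integrableOn_Ioi_rpow_of_lt (by norm_num) hκ)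
    have h3 := ((integrable_indicator_iff measurableSet_Ici).2 h2).integrableOn (s := Set.Ioi 0)
    refine h3.congr_fun (fun r hr => ?_) measurableSet_Ioi
    have hr0 : (r : ℝ) ≠ 0 := (Set.mem_Ioi.1 hr).ne'
    simp only [finrank_euclideanSpace, Fintype.card_fin, smul_eq_mul]
    by_cases hk : r ∈ Set.Ici κ
    · simp only [Set.indicator_of_mem hk]
      obtain ⟨m, rfl⟩ : ∃ m, n = m + 1 := ⟨n - 1, by omega⟩
      rw [Real.rpow_neg (Set.mem_Ioi.1 hr).le]
      simp only [Nat.add_sub_cancel, Real.rpow_ofNat]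
      field_simp
      ring
    · simp [Set.indicator_of_notMem hk]
  refine h.congr (Eventually.of_forall fun z => ?_)
  simp only [Set.indicator, Set.mem_Ici, Set.mem_compl_iff, Metric.mem_ball, dist_zero_right,
    not_lt]

theorem tendsto_setIntegral_ball_diff_ball {g : Rn n → ℝ} {κ : ℝ}
    (hg : IntegrableOn g (Metric.ball 0 κ)) (h0 : g 0 = 0) :
    Tendsto (fun ε : ℝ => ∫ z in Metric.ball (0 : Rn n) κ \ Metric.ball 0 ε, g z) (𝓝[>] 0)
      (𝓝 (∫ z in Metric.ball 0 κ, g z)) := by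
  have hm : ∀ r : ℝ, MeasurableSet (Metric.ball (0 : Rn n) r) :=
    fun r => Metric.isOpen_ball.measurableSet
  have h1 : ∀ ε : ℝ, ∫ z in Metric.ball (0 : Rn n) κ \ Metric.ball 0 ε, g z
      = ∫ z in Metric.ball (0 : Rn n) κ, (Metric.ball 0 ε)ᶜ.indicator g z := fun ε => by
    rw [setIntegral_indicator (hm ε).compl, Set.sdiff_eq]
  simp only [h1]
  refine tendsto_integral_filter_of_dominated_convergence (fun z => ‖g z‖)
    (Eventually.of_forall fun ε => hg.aestronglyMeasurable.indicator (hm ε).compl)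
    (Eventually.of_forall fun ε => Eventually.of_forall fun z => norm_indicator_le_norm_self _ _)
    hg.norm (Eventually.of_forall fun z => ?_)
  rcases eq_or_ne z 0 with rfl | hz
  · refine tendsto_const_nhds.congr fun ε => ?_
    simp [Set.indicator, h0]
  · refine tendsto_const_nhds.congr' ?_
    filter_upwards [Ioo_mem_nhdsGT (norm_pos_iff.2 hz)] with ε hε
    rw [Set.indicator_of_mem]
    simpa using hε.2.le

/-- The absolutely convergent form of the principal value
`p.v. ∫_{|z| < κ} (φ(x+z) - φ(x)) / |z|^(n+1) dz`: the first order Taylor term, which has integral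
zero over every annulus, is subtracted. -/
noncomputable def taylorIntegral (κ : ℝ) (φ : Rn n → ℝ) (x : Rn n) : ℝ :=
  ∫ z in Metric.ball (0 : Rn n) κ, (φ (x + z) - φ x - fderiv ℝ φ x z) / ‖z‖ ^ (n + 1)

/-- The value of `taylorIntegral κ` on the function `‖· - y‖ ^ 2`, at any point. -/
noncomputable def sqIntegral (n : ℕ) (κ : ℝ) : ℝ :=
  ∫ z in Metric.ball (0 : Rn n) κ, ‖z‖ ^ 2 / ‖z‖ ^ (n + 1)

theorem tendsto_sqIntegral_zero (hn : 1 ≤ n) : Tendsto (sqIntegral n) (𝓝[>] 0) (𝓝 0) := by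
  have hi := integrableOn_ball_sq_div hn 1
  have h := (tendsto_setIntegral_ball_diff_ball hi (by simp)).const_sub (sqIntegral n 1)
  rw [← sqIntegral, sub_self] at h
  refine h.congr' ?_
  filter_upwards [Ioo_mem_nhdsGT (zero_lt_one' ℝ)] with ε hε
  rw [setIntegral_sdiff Metric.isOpen_ball.measurableSet hi (Metric.ball_subset_ball hε.2.le)]
  simp [sqIntegral]

/-- The Taylor estimate is uniform in the base point near `x₀`; this gives the dominating function
for the continuity of `taylorIntegral` in the base point. -/
theorem exists_taylor_bound {φ : Rn n → ℝ} (hφ : ContDiff ℝ 2 φ) (x₀ : Rn n) (κ : ℝ) :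
    ∃ C : ℝ, ∀ x ∈ Metric.ball x₀ 1, ∀ z ∈ Metric.ball (0 : Rn n) κ,
      |φ (x + z) - φ x - fderiv ℝ φ x z| ≤ C * ‖z‖ ^ 2 := by
  have h1 : ContDiff ℝ 1 (fderiv ℝ φ) := hφ.fderiv_right (by norm_num)
  have h2 : Continuous fun y => ‖fderiv ℝ (fderiv ℝ φ) y‖ :=
    continuous_norm.comp (h1.continuous_fderiv (by norm_num))
  obtain ⟨C, hC⟩ := (isCompact_closedBall x₀ (1 + κ)).bddAbove_image h2.continuousOn
  replace hC : ∀ y ∈ Metric.closedBall x₀ (1 + κ), ‖fderiv ℝ (fderiv ℝ φ) y‖ ≤ C :=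
    fun y hy => hC (Set.mem_image_of_mem _ hy)
  refine ⟨C, fun x hx z hz => ?_⟩
  rw [Metric.mem_ball, dist_eq_norm] at hx
  rw [mem_ball_zero_iff] at hz
  have hseg : ∀ y ∈ segment ℝ x (x + z), ‖y - x‖ ≤ ‖z‖ ∧ y ∈ Metric.closedBall x₀ (1 + κ) := by
    intro y hy
    have h3 : ‖y - x‖ ≤ ‖z‖ := by
      have := norm_sub_le_of_mem_segment hy
      simpa using this
    refine ⟨h3, ?_⟩
    rw [Metric.mem_closedBall, dist_eq_norm, ← sub_add_sub_cancel y x x₀]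
    linarith [norm_add_le (y - x) (x - x₀)]
  have hC0 : 0 ≤ C :=
    (norm_nonneg (fderiv ℝ (fderiv ℝ φ) x)).trans (hC x (hseg x (left_mem_segment _ _ _)).2)
  have h4 : ∀ y ∈ segment ℝ x (x + z), ‖fderiv ℝ φ y - fderiv ℝ φ x‖ ≤ C * ‖z‖ := by
    intro y hy
    refine ((convex_closedBall x₀ (1 + κ)).norm_image_sub_le_of_norm_fderiv_le
      (fun w _ => (h1.differentiable (by norm_num)) w) hC
      (hseg x (left_mem_segment _ _ _)).2 (hseg y hy).2).trans ?_
    gcongr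
    exact (hseg y hy).1
  have h5 := (convex_segment x (x + z)).norm_image_sub_le_of_norm_fderiv_le'
    (fun w _ => (hφ.differentiable (by norm_num)) w) h4 (left_mem_segment _ _ _)
    (right_mem_segment _ _ _)
  rw [add_sub_cancel_left, Real.norm_eq_abs] at h5
  linarith

theorem measurable_kernel : Measurable fun z : Rn n => ‖z‖ ^ (n + 1) :=
  (measurable_norm.pow_const _)

theorem measurable_taylor {φ : Rn n → ℝ} (hφ : ContDiff ℝ 2 φ) (x : Rn n) :
    Measurable fun z => (φ (x + z) - φ x - fderiv ℝ φ x z) / ‖z‖ ^ (n + 1) := by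
  have := hφ.continuous
  refine Measurable.div (Continuous.measurable ?_) measurable_kernel
  fun_prop

theorem integrableOn_taylor (hn : 1 ≤ n) {φ : Rn n → ℝ} (hφ : ContDiff ℝ 2 φ) (κ : ℝ) (x : Rn n) :
    IntegrableOn (fun z => (φ (x + z) - φ x - fderiv ℝ φ x z) / ‖z‖ ^ (n + 1))
      (Metric.ball 0 κ) := by
  obtain ⟨C, hC⟩ := exists_taylor_bound hφ x κ
  refine ((integrableOn_ball_sq_div hn κ).const_mul C).mono'
    (measurable_taylor hφ x).aestronglyMeasurable ?_
  refine (ae_restrict_iff' Metric.isOpen_ball.measurableSet).2 (Eventually.of_forall fun z hz => ?_)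
  rw [norm_div, Real.norm_eq_abs, Real.norm_of_nonneg (by positivity), ← mul_div_assoc]
  gcongr
  exact hC x (Metric.mem_ball_self one_pos) z hz

theorem tendsto_taylorIntegral (hn : 1 ≤ n) {φ : Rn n → ℝ} (hφ : ContDiff ℝ 2 φ) (κ : ℝ)
    (x₀ : Rn n) : Tendsto (taylorIntegral κ φ) (𝓝 x₀) (𝓝 (taylorIntegral κ φ x₀)) := by
  obtain ⟨C, hC⟩ := exists_taylor_bound hφ x₀ κ
  refine tendsto_integral_filter_of_dominated_convergence
    (fun z => C * (‖z‖ ^ 2 / ‖z‖ ^ (n + 1)))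
    (Eventually.of_forall fun x => (measurable_taylor hφ x).aestronglyMeasurable) ?_
    ((integrableOn_ball_sq_div hn κ).const_mul C) (Eventually.of_forall fun z => ?_)
  · filter_upwards [Metric.ball_mem_nhds x₀ one_pos] with x hx
    refine (ae_restrict_iff' Metric.isOpen_ball.measurableSet).2
      (Eventually.of_forall fun z hz => ?_)
    rw [norm_div, Real.norm_eq_abs, Real.norm_of_nonneg (by positivity), ← mul_div_assoc]
    gcongr
    exact hC x hx z hz
  · have h1 := hφ.continuous
    have h2 : Continuous (fderiv ℝ φ) := hφ.continuous_fderiv (by norm_num)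
    have h3 : Continuous fun x => (φ (x + z) - φ x - fderiv ℝ φ x z) / ‖z‖ ^ (n + 1) := by
      fun_prop
    exact h3.tendsto x₀

theorem integrableOn_linear_annulus (l : Rn n →L[ℝ] ℝ) (κ : ℝ) {ε : ℝ} (hε : 0 < ε) :
    IntegrableOn (fun z => l z / ‖z‖ ^ (n + 1)) (Metric.ball (0 : Rn n) κ \ Metric.ball 0 ε) := by
  refine Measure.integrableOn_of_bounded (M := ‖l‖ * κ / ε ^ (n + 1))
    ((measure_mono Set.sdiff_subset).trans_lt measure_ball_lt_top).ne
    ((l.continuous.measurable.div measurable_kernel).aestronglyMeasurable) ?_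
  refine (ae_restrict_iff' (Metric.isOpen_ball.measurableSet.diff
    Metric.isOpen_ball.measurableSet)).2 (Eventually.of_forall fun z hz => ?_)
  have h1 : ‖z‖ < κ := mem_ball_zero_iff.1 hz.1
  have h2 : ε ≤ ‖z‖ := by simpa using hz.2
  rw [norm_div, Real.norm_of_nonneg (by positivity : 0 ≤ ‖z‖ ^ (n + 1))]
  have h3 : ‖l z‖ ≤ ‖l‖ * κ := (l.le_opNorm z).trans (by gcongr)
  have h4 : 0 ≤ ‖l‖ * κ := (norm_nonneg _).trans h3
  gcongr

theorem setIntegral_linear_annulus (l : Rn n →L[ℝ] ℝ) (κ ε : ℝ) :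
    ∫ z in Metric.ball (0 : Rn n) κ \ Metric.ball 0 ε, l z / ‖z‖ ^ (n + 1) = 0 := by
  have hm : MeasurableSet (Metric.ball (0 : Rn n) κ \ Metric.ball 0 ε) :=
    Metric.isOpen_ball.measurableSet.diff Metric.isOpen_ball.measurableSet
  rw [← integral_indicator hm]
  set g := (Metric.ball (0 : Rn n) κ \ Metric.ball 0 ε).indicator fun z => l z / ‖z‖ ^ (n + 1)
    with hg
  have hodd : ∀ z, g (-z) = -g z := fun z => by
    simp only [hg, Set.indicator, Set.mem_sdiff, mem_ball_zero_iff, norm_neg, map_neg]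
    split_ifs
    · rw [neg_div]
    · rw [neg_zero]
  have h := integral_neg_eq_self g volume
  simp only [hodd, integral_neg] at h
  linarith

theorem integrableOn_diff_annulus (hn : 1 ≤ n) {φ : Rn n → ℝ} (hφ : ContDiff ℝ 2 φ) {κ ε : ℝ}
    (hε : 0 < ε) (x : Rn n) :
    IntegrableOn (fun z => (φ (x + z) - φ x) / ‖z‖ ^ (n + 1))
      (Metric.ball 0 κ \ Metric.ball 0 ε) := by
  refine (((integrableOn_taylor hn hφ κ x).mono_set Set.sdiff_subset).add
    (integrableOn_linear_annulus (fderiv ℝ φ x) κ hε)).congr (Eventually.of_forall fun z => ?_)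
  simp only [Pi.add_apply]
  ring

theorem setIntegral_diff_annulus (hn : 1 ≤ n) {φ : Rn n → ℝ} (hφ : ContDiff ℝ 2 φ) {κ ε : ℝ}
    (hε : 0 < ε) (x : Rn n) :
    ∫ z in Metric.ball 0 κ \ Metric.ball 0 ε, (φ (x + z) - φ x) / ‖z‖ ^ (n + 1)
      = ∫ z in Metric.ball 0 κ \ Metric.ball 0 ε,
          (φ (x + z) - φ x - fderiv ℝ φ x z) / ‖z‖ ^ (n + 1) := by
  rw [← add_zero (∫ z in Metric.ball 0 κ \ Metric.ball 0 ε,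
    (φ (x + z) - φ x - fderiv ℝ φ x z) / ‖z‖ ^ (n + 1)),
    ← setIntegral_linear_annulus (fderiv ℝ φ x) κ ε,
    ← integral_add ((integrableOn_taylor hn hφ κ x).mono_set Set.sdiff_subset)
      (integrableOn_linear_annulus (fderiv ℝ φ x) κ hε)]
  refine integral_congr_ae (Eventually.of_forall fun z => ?_)
  simp only
  ring

theorem innerHalfLap_eq (hn : 1 ≤ n) {φ : Rn n → ℝ} (hφ : ContDiff ℝ 2 φ) (κ : ℝ) (x : Rn n) :
    innerHalfLap κ φ x = -halfLapConst n * taylorIntegral κ φ x := by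
  unfold innerHalfLap
  congr 1
  refine Tendsto.limUnder_eq ?_
  refine (tendsto_setIntegral_ball_diff_ball (integrableOn_taylor hn hφ κ x) (by simp)).congr' ?_
  filter_upwards [self_mem_nhdsWithin] with ε hε
  exact (setIntegral_diff_annulus hn hφ hε x).symm

theorem setIntegral_annulus_eq_sub (hn : 1 ≤ n) {φ : Rn n → ℝ} (hφ : ContDiff ℝ 2 φ) {κ ε : ℝ}
    (hε : 0 < ε) (hεκ : ε ≤ κ) (x : Rn n) :
    ∫ z in Metric.ball 0 κ \ Metric.ball 0 ε, (φ (x + z) - φ x) / ‖z‖ ^ (n + 1)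
      = taylorIntegral κ φ x - taylorIntegral ε φ x := by
  rw [setIntegral_diff_annulus hn hφ hε, setIntegral_sdiff Metric.isOpen_ball.measurableSet
    (integrableOn_taylor hn hφ κ x) (Metric.ball_subset_ball hεκ)]
  rfl

theorem taylorIntegral_add (hn : 1 ≤ n) {φ ψ : Rn n → ℝ} (hφ : ContDiff ℝ 2 φ)
    (hψ : ContDiff ℝ 2 ψ) (κ : ℝ) (x : Rn n) :
    taylorIntegral κ (fun y => φ y + ψ y) x = taylorIntegral κ φ x + taylorIntegral κ ψ x := by
  unfold taylorIntegral
  rw [← integral_add (integrableOn_taylor hn hφ κ x) (integrableOn_taylor hn hψ κ x)]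
  refine integral_congr_ae (Eventually.of_forall fun z => ?_)
  simp only
  rw [fderiv_fun_add (hφ.differentiable (by norm_num) x) (hψ.differentiable (by norm_num) x)]
  simp only [_root_.add_apply]
  ring

theorem taylorIntegral_neg {φ : Rn n → ℝ} (κ : ℝ) (x : Rn n) :
    taylorIntegral κ (fun y => -φ y) x = -taylorIntegral κ φ x := by
  unfold taylorIntegral
  rw [← integral_neg]
  refine integral_congr_ae (Eventually.of_forall fun z => ?_)
  simp only
  rw [fderiv_fun_neg]
  simp only [_root_.neg_apply]
  ring

theorem hasFDerivAt_mul_norm_sub_sq (δ : ℝ) (y x : Rn n) :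
    HasFDerivAt (fun x => δ * ‖x - y‖ ^ 2) (innerSL ℝ ((2 * δ) • (x - y))) x := by
  have h := (((hasStrictFDerivAt_norm_sq (x - y)).hasFDerivAt).comp x
    ((hasFDerivAt_id x).sub_const y)).const_mul δ
  refine h.congr_fderiv ?_
  ext z
  simp
  ring

theorem taylorIntegral_mul_norm_sub_sq (κ δ : ℝ) (y x : Rn n) :
    taylorIntegral κ (fun x => δ * ‖x - y‖ ^ 2) x = δ * sqIntegral n κ := by
  unfold taylorIntegral sqIntegral
  rw [← integral_const_mul]
  refine integral_congr_ae (Eventually.of_forall fun z => ?_)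
  simp only
  rw [(hasFDerivAt_mul_norm_sub_sq δ y x).fderiv, add_sub_right_comm, norm_add_sq_real,
    innerSL_apply_apply, inner_smul_left, ← mul_div_assoc]
  simp only [conj_trivial]
  ring

theorem contDiff_mul_norm_sub_sq (δ : ℝ) (y : Rn n) :
    ContDiff ℝ 2 fun x => δ * ‖x - y‖ ^ 2 :=
  contDiff_const.mul ((contDiff_id.sub contDiff_const).norm_sq ℝ)

theorem integrableOn_compl_ball_diff (hn : 1 ≤ n) {κ : ℝ} (hκ : 0 < κ) {u : Rn n → ℝ}
    (hu : Continuous u) {M : ℝ} (hM : ∀ x, |u x| ≤ M) (x : Rn n) :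
    IntegrableOn (fun z => (u (x + z) - u x) / ‖z‖ ^ (n + 1)) (Metric.ball 0 κ)ᶜ := by
  refine ((integrableOn_compl_ball_kernel hn hκ).const_mul (2 * M)).mono' ?_
    (Eventually.of_forall fun z => ?_)
  · refine (Measurable.div (Continuous.measurable ?_) measurable_kernel).aestronglyMeasurable
    fun_prop
  · rw [norm_div, Real.norm_eq_abs, Real.norm_of_nonneg (by positivity), ← mul_div_assoc, mul_one]
    gcongr
    linarith [abs_sub (u (x + z)) (u x), hM (x + z), hM x]

/-- For a bounded continuous function the nonsingular part of the operator is continuous in the point. -/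
theorem tendsto_setIntegral_compl_ball (hn : 1 ≤ n) {κ : ℝ} (hκ : 0 < κ) {u : Rn n → ℝ}
    (hu : Continuous u) {M : ℝ} (hM : ∀ x, |u x| ≤ M) (x₀ : Rn n) :
    Tendsto (fun x => ∫ z in (Metric.ball 0 κ)ᶜ, (u (x + z) - u x) / ‖z‖ ^ (n + 1)) (𝓝 x₀)
      (𝓝 (∫ z in (Metric.ball 0 κ)ᶜ, (u (x₀ + z) - u x₀) / ‖z‖ ^ (n + 1))) := by
  refine tendsto_integral_filter_of_dominated_convergence (fun z => 2 * M * (1 / ‖z‖ ^ (n + 1)))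
    (Eventually.of_forall fun x =>
      (integrableOn_compl_ball_diff hn hκ hu hM x).aestronglyMeasurable)
    (Eventually.of_forall fun x => Eventually.of_forall fun z => ?_)
    ((integrableOn_compl_ball_kernel hn hκ).const_mul (2 * M)) (Eventually.of_forall fun z => ?_)
  · rw [norm_div, Real.norm_eq_abs, Real.norm_of_nonneg (by positivity), ← mul_div_assoc, mul_one]
    gcongr
    linarith [abs_sub (u (x + z)) (u x), hM (x + z), hM x]
  · have h3 : Continuous fun x => (u (x + z) - u x) / ‖z‖ ^ (n + 1) := by fun_prop
    exact h3.tendsto x₀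

theorem halfLapConst_pos (n : ℕ) : 0 < halfLapConst n :=
  div_pos (Real.Gamma_pos_of_pos (by positivity)) (Real.rpow_pos_of_pos Real.pi_pos _)

end Integrals

/-! ### Doubling of variables -/

section Doubling

variable {n : ℕ}

theorem gradient_add {φ ψ : Rn n → ℝ} {x : Rn n} (hφ : DifferentiableAt ℝ φ x)
    (hψ : DifferentiableAt ℝ ψ x) :
    gradient (fun y => φ y + ψ y) x = gradient φ x + gradient ψ x := by
  rw [gradient, fderiv_fun_add hφ hψ, map_add]
  rfl

theorem gradient_neg (φ : Rn n → ℝ) (x : Rn n) :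
    gradient (fun y => -φ y) x = -gradient φ x := by
  rw [gradient, fderiv_fun_neg, map_neg]
  rfl

theorem gradient_mul_norm_sub_sq (δ : ℝ) (y x : Rn n) :
    gradient (fun x => δ * ‖x - y‖ ^ 2) x = (2 * δ) • (x - y) :=
  (hasGradientAt_iff_hasFDerivAt.2 (hasFDerivAt_mul_norm_sub_sq δ y x)).gradient

theorem continuous_gradient {φ : Rn n → ℝ} (hφ : ContDiff ℝ 2 φ) : Continuous (gradient φ) :=
  (InnerProductSpace.toDual ℝ (Rn n)).symm.continuous.comp
    (hφ.continuous_fderiv (by norm_num))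

/-- Maximum points of the function with doubled variables, penalized by
`δ |x - x₀|² + δ⁻² |x - y|²`. The first term makes the maximum exist although `φ` may be
unbounded; the Lipschitz bound on `v` controls the distance of the two points. -/
theorem exists_doubling_max {u v φ : Rn n → ℝ} {L : ℝ≥0} (hu : Continuous u)
    (hv : LipschitzWith L v) (hφ : Continuous φ) {x₀ : Rn n}
    (hmax : ∀ y, u y - v y - φ y ≤ u x₀ - v x₀ - φ x₀) {δ : ℝ} (hδ : 0 < δ) :
    ∃ x y : Rn n, ‖x - y‖ ≤ L * δ ^ 2 ∧ ‖x - x₀‖ ^ 2 ≤ L ^ 2 * δ ∧ ∀ x' y' : Rn n,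
      u x' - v y' - φ x' - δ * ‖x' - x₀‖ ^ 2 - (δ ^ 2)⁻¹ * ‖x' - y'‖ ^ 2
        ≤ u x - v y - φ x - δ * ‖x - x₀‖ ^ 2 - (δ ^ 2)⁻¹ * ‖x - y‖ ^ 2 := by
  set Φ : Rn n × Rn n → ℝ := fun q =>
    u q.1 - v q.2 - φ q.1 - δ * ‖q.1 - x₀‖ ^ 2 - (δ ^ 2)⁻¹ * ‖q.1 - q.2‖ ^ 2 with hΦ
  have hcont : Continuous Φ := by
    have := hv.continuous
    fun_prop
  have hloc : ∀ x y, Φ (x₀, x₀) ≤ Φ (x, y) →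
      ‖x - y‖ ≤ L * δ ^ 2 ∧ ‖x - x₀‖ ^ 2 ≤ L ^ 2 * δ := by
    intro x y hxy
    simp only [hΦ, sub_self, norm_zero] at hxy
    have h1 : v x - v y ≤ L * ‖x - y‖ := by
      have := hv.dist_le_mul x y
      rw [Real.dist_eq, dist_eq_norm] at this
      exact (le_abs_self _).trans this
    have h2 := hmax x
    have h3 : δ * ‖x - x₀‖ ^ 2 + (δ ^ 2)⁻¹ * ‖x - y‖ ^ 2 ≤ L * ‖x - y‖ := by linarith
    have h4 : ‖x - y‖ ≤ L * δ ^ 2 := by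
      have h5 : (δ ^ 2)⁻¹ * ‖x - y‖ ^ 2 ≤ L * ‖x - y‖ :=
        (le_add_of_nonneg_left (by positivity)).trans h3
      rw [inv_mul_le_iff₀ (by positivity)] at h5
      rcases (norm_nonneg (x - y)).eq_or_lt with h6 | h6
      · rw [← h6]; positivity
      · refine le_of_mul_le_mul_right ?_ h6
        linarith
    refine ⟨h4, le_of_mul_le_mul_left ?_ hδ⟩
    have h7 : δ * ‖x - x₀‖ ^ 2 ≤ L * ‖x - y‖ :=
      (le_add_of_nonneg_right (by positivity)).trans h3
    have h8 : (L : ℝ) * ‖x - y‖ ≤ L * (L * δ ^ 2) := by gcongr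
    linarith
  set R : ℝ := 1 + L ^ 2 * δ + L * δ ^ 2 with hR
  have hR0 : 0 ≤ R := by positivity
  have hmem : ∀ x y, Φ (x₀, x₀) ≤ Φ (x, y) →
      (x, y) ∈ Metric.closedBall x₀ R ×ˢ Metric.closedBall x₀ R := by
    intro x y hxy
    obtain ⟨h1, h2⟩ := hloc x y hxy
    have h3 : ‖x - x₀‖ ≤ 1 + L ^ 2 * δ := by nlinarith [sq_nonneg (‖x - x₀‖ - 1)]
    have h4 : 0 ≤ (L : ℝ) * δ ^ 2 := by positivity
    have h5 : ‖y - x₀‖ ≤ ‖x - y‖ + ‖x - x₀‖ := by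
      rw [norm_sub_rev x y]
      exact norm_sub_le_norm_sub_add_norm_sub y x x₀
    simp only [Set.mem_prod, Metric.mem_closedBall, dist_eq_norm]
    constructor <;> linarith
  obtain ⟨⟨x, y⟩, -, hxy⟩ := ((isCompact_closedBall x₀ R).prod
    (isCompact_closedBall x₀ R)).exists_isMaxOn
      ⟨(x₀, x₀), hmem x₀ x₀ le_rfl⟩ hcont.continuousOn
  have h0 : Φ (x₀, x₀) ≤ Φ (x, y) := hxy (hmem x₀ x₀ le_rfl)
  refine ⟨x, y, (hloc x y h0).1, (hloc x y h0).2, fun x' y' => ?_⟩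
  rcases le_total (Φ (x₀, x₀)) (Φ (x', y')) with h | h
  · exact hxy (hmem x' y' h)
  · exact h.trans h0

theorem outerHalfLap_eq_add (hn : 1 ≤ n) {ε κ : ℝ} (hε : 0 < ε) (hεκ : ε ≤ κ) {u : Rn n → ℝ}
    (hu : Continuous u) {M : ℝ} (hM : ∀ x, |u x| ≤ M) (x : Rn n) :
    outerHalfLap ε u x = -halfLapConst n *
      (∫ z in Metric.ball (0 : Rn n) κ \ Metric.ball 0 ε, (u (x + z) - u x) / ‖z‖ ^ (n + 1))
        + outerHalfLap κ u x := by
  have hb : ∀ r, MeasurableSet (Metric.ball (0 : Rn n) r) :=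
    fun r => Metric.isOpen_ball.measurableSet
  have hdisj : Disjoint (Metric.ball (0 : Rn n) κ \ Metric.ball 0 ε) (Metric.ball 0 κ)ᶜ :=
    Set.disjoint_left.2 fun z hz hz' => hz' hz.1
  have hset : (Metric.ball (0 : Rn n) ε)ᶜ
      = (Metric.ball 0 κ \ Metric.ball 0 ε) ∪ (Metric.ball 0 κ)ᶜ := by
    have := Metric.ball_subset_ball (x := (0 : Rn n)) hεκ
    ext z
    have := @this z
    simp only [Set.mem_compl_iff, Set.mem_union, Set.mem_sdiff]
    tauto
  have hi := integrableOn_compl_ball_diff hn hε hu hM x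
  unfold outerHalfLap
  rw [hset] at hi ⊢
  rw [setIntegral_union hdisj (hb κ).compl
    (hi.mono_set Set.subset_union_left) (hi.mono_set Set.subset_union_right)]
  ring

/-- Moving both points of a maximum of `u(x) - v(y) - θ(x)` by the same vector `z` bounds the
increments of `u - v` by those of `θ`. On the annulus `ε ≤ |z| < κ` this replaces the nonlocal terms
of `u` and `v` by the one of the smooth function `θ`. -/
theorem outerHalfLap_sub_ge (hn : 1 ≤ n) {ε κ : ℝ} (hε : 0 < ε) (hεκ : ε ≤ κ)
    {u v θ : Rn n → ℝ} (hu : Continuous u) (hv : Continuous v) {M : ℝ} (hMu : ∀ x, |u x| ≤ M)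
    (hMv : ∀ x, |v x| ≤ M) (hθ : ContDiff ℝ 2 θ) {x y : Rn n}
    (hmax : ∀ z, u (x + z) - v (y + z) - θ (x + z) ≤ u x - v y - θ x) :
    -halfLapConst n * (taylorIntegral κ θ x - taylorIntegral ε θ x)
        + (outerHalfLap κ u x - outerHalfLap κ v y)
      ≤ outerHalfLap ε u x - outerHalfLap ε v y := by
  have hsub : Metric.ball (0 : Rn n) κ \ Metric.ball 0 ε ⊆ (Metric.ball 0 ε)ᶜ := fun z hz => hz.2
  have hiu := (integrableOn_compl_ball_diff hn hε hu hMu x).mono_set hsub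
  have hiv := (integrableOn_compl_ball_diff hn hε hv hMv y).mono_set hsub
  have h : (∫ z in Metric.ball (0 : Rn n) κ \ Metric.ball 0 ε, (u (x + z) - u x) / ‖z‖ ^ (n + 1))
      - ∫ z in Metric.ball (0 : Rn n) κ \ Metric.ball 0 ε, (v (y + z) - v y) / ‖z‖ ^ (n + 1)
      ≤ taylorIntegral κ θ x - taylorIntegral ε θ x := by
    rw [← setIntegral_annulus_eq_sub hn hθ hε hεκ, ← integral_sub hiu hiv]
    refine integral_mono (hiu.sub hiv) (integrableOn_diff_annulus hn hθ hε x) fun z => ?_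
    simp only
    rw [← sub_div]
    exact div_le_div_of_nonneg_right (by linarith [hmax z]) (by positivity)
  rw [outerHalfLap_eq_add hn hε hεκ hu hMu, outerHalfLap_eq_add hn hε hεκ hv hMv]
  have := mul_le_mul_of_nonneg_left h (halfLapConst_pos n).le
  linarith

/-- What the inequalities for `u` and `v` say at a maximum point of the function with doubled
variables: the singular parts cancel up to `O(δ)`. -/
theorem exists_doubling_estimate (hn : 1 ≤ n) {G₁ G₂ : Rn n → ℝ → Rn n → ℝ → ℝ}
    {u v φ : Rn n → ℝ} {M L : ℝ≥0} {A B C d : ℝ} (hC : 0 ≤ C) (hd : 0 ≤ d)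
    (hG : ∀ x y r s p q t τ, G₁ x r p t ≤ 0 → 0 ≤ G₂ y s q τ →
      t - τ ≤ C * (1 + |s| + ‖q‖) * (‖x - y‖ + d) + B * |r - s| + A * ‖p - q‖)
    (hMu : ∀ x, |u x| ≤ M) (hMv : ∀ x, |v x| ≤ M)
    (hu : Continuous u) (hv : LipschitzWith L v)
    (h1 : IsViscositySubsolution G₁ u) (h2 : IsViscositySupersolution G₂ v)
    (hφ : ContDiff ℝ 2 φ) {x₀ : Rn n}
    (hmax : ∀ y, u y - v y - φ y ≤ u x₀ - v x₀ - φ x₀) {κ : ℝ} (hκ : κ ∈ Set.Ioo (0 : ℝ) 1)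
    {δ : ℝ} (hδ : 0 < δ) :
    ∃ x y : Rn n, ‖x - y‖ ≤ L * δ ^ 2 ∧ ‖x - x₀‖ ^ 2 ≤ L ^ 2 * δ ∧
      -halfLapConst n * (taylorIntegral κ φ x + δ * sqIntegral n κ + 2 * δ)
        + (outerHalfLap κ u x - outerHalfLap κ v y)
      ≤ C * (1 + M + 2 * L) * (L * δ ^ 2 + d) + B * |u x - v y|
        + A * ‖gradient φ x + (2 * δ) • (x - x₀)‖ := by
  obtain ⟨x, y, hxy, hx, hdbl⟩ := exists_doubling_max hu hv hφ.continuous hmax hδ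
  refine ⟨x, y, hxy, hx, ?_⟩
  set k : ℝ := (δ ^ 2)⁻¹ with hk
  have hk0 : 0 < k := by positivity
  -- The radius `ε` is so small that the singular parts of the penalization `k |x - y|²` are at
  -- most `δ`.
  obtain ⟨ε, ⟨hε0, hεκ⟩, hε⟩ : ∃ ε ∈ Set.Ioo 0 κ, k * sqIntegral n ε < δ := by
    have h3 : Tendsto (fun ε => k * sqIntegral n ε) (𝓝[>] 0) (𝓝 0) := by
      simpa using (tendsto_sqIntegral_zero hn).const_mul k
    have h4 : ∀ᶠ ε in 𝓝[>] (0 : ℝ), ε ∈ Set.Ioo 0 κ := Ioo_mem_nhdsGT hκ.1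
    exact (h4.and (h3.eventually_lt_const hδ)).exists
  set θ : Rn n → ℝ := fun w => φ w + δ * ‖w - x₀‖ ^ 2 with hθ
  have hθ2 : ContDiff ℝ 2 θ := hφ.add (contDiff_mul_norm_sub_sq δ x₀)
  have hε1 : ε ∈ Set.Ioo (0 : ℝ) 1 := ⟨hε0, hεκ.trans hκ.2⟩
  have hc := halfLapConst_pos n
  have hsub := h1.2.2 (fun w => θ w + k * ‖w - y‖ ^ 2)
    (hθ2.add (contDiff_mul_norm_sub_sq k y)) x
    (fun w => by have := hdbl w y; simp only [hθ]; linarith) ε hε1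
  have hsup := h2.2.2 (fun w => -k * ‖w - x‖ ^ 2) (contDiff_mul_norm_sub_sq (-k) x) y
    (fun w => by
      have := hdbl x w
      simp only [norm_sub_rev _ x]
      linarith) ε hε1
  have key := hG _ _ _ _ _ _ _ _ hsub hsup
  rw [innerHalfLap_eq hn (hθ2.add (contDiff_mul_norm_sub_sq k y)),
    innerHalfLap_eq hn (contDiff_mul_norm_sub_sq (-k) x),
    taylorIntegral_add hn hθ2 (contDiff_mul_norm_sub_sq k y), taylorIntegral_mul_norm_sub_sq,
    taylorIntegral_mul_norm_sub_sq,
    gradient_add (hθ2.differentiable (by norm_num) x)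
      ((contDiff_mul_norm_sub_sq k y).differentiable (by norm_num) x),
    gradient_add (hφ.differentiable (by norm_num) x)
      ((contDiff_mul_norm_sub_sq δ x₀).differentiable (by norm_num) x),
    gradient_mul_norm_sub_sq, gradient_mul_norm_sub_sq, gradient_mul_norm_sub_sq] at key
  have hp : gradient φ x + (2 * δ) • (x - x₀) + (2 * k) • (x - y) - (2 * -k) • (y - x)
      = gradient φ x + (2 * δ) • (x - x₀) := by module
  rw [hp] at key
  have hq : ‖(2 * -k) • (y - x)‖ ≤ 2 * L := by
    rw [norm_smul, norm_sub_rev, mul_neg, norm_neg, Real.norm_of_nonneg (by positivity)]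
    calc 2 * k * ‖x - y‖ ≤ 2 * k * (L * δ ^ 2) := by gcongr
      _ = 2 * L := by rw [hk]; field_simp
  have h3 : C * (1 + |v y| + ‖(2 * -k) • (y - x)‖) * (‖x - y‖ + d)
      ≤ C * (1 + M + 2 * L) * (L * δ ^ 2 + d) := by
    gcongr
    exact hMv y
  have h4 := outerHalfLap_sub_ge hn hε0 hεκ.le hu hv.continuous hMu hMv hθ2 (x := x) (y := y)
    (fun z => by
      have := hdbl (x + z) (y + z)
      rw [add_sub_add_right_eq_sub] at this
      simp only [hθ]
      linarith)
  have h5 : taylorIntegral κ θ x = taylorIntegral κ φ x + δ * sqIntegral n κ := by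
    rw [hθ, taylorIntegral_add hn hφ (contDiff_mul_norm_sub_sq δ x₀),
      taylorIntegral_mul_norm_sub_sq]
  have h6 := mul_le_mul_of_nonneg_left hε.le hc.le
  rw [h5] at h4
  linarith

/-- Doubling of variables: the difference of a subsolution and a supersolution is a subsolution of
an extremal equation, provided that the two operators admit a comparison of their nonlocal
arguments. -/
theorem isViscositySubsolution_sub (hn : 1 ≤ n) {G₁ G₂ : Rn n → ℝ → Rn n → ℝ → ℝ}
    {u v : Rn n → ℝ} {M L : ℝ≥0} {A B C d S lam : ℝ} (hB : 0 ≤ B) (hC : 0 ≤ C)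
    (hd : 0 ≤ d) (hlam : 0 ≤ lam)
    (hG : ∀ x y r s p q t τ, G₁ x r p t ≤ 0 → 0 ≤ G₂ y s q τ →
      t - τ ≤ C * (1 + |s| + ‖q‖) * (‖x - y‖ + d) + B * |r - s| + A * ‖p - q‖)
    (hMu : ∀ x, |u x| ≤ M) (hMv : ∀ x, |v x| ≤ M)
    (hu : Continuous u) (hv : LipschitzWith L v) (hS : ∀ x, |u x - v x| ≤ S)
    (h1 : IsViscositySubsolution G₁ u) (h2 : IsViscositySupersolution G₂ v) :
    IsViscositySubsolution
      (lowerExtremal A ((B + lam) * S + C * (1 + M + 2 * L) * d) lam)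
      (fun x => u x - v x) := by
  refine ⟨(hu.sub hv.continuous).upperSemicontinuous, ⟨S, hS⟩, ?_⟩
  intro φ hφ x₀ hmax κ hκ
  choose! x y hxy hx hest using fun δ (hδ : (0 : ℝ) < δ) =>
    exists_doubling_estimate hn hC hd hG hMu hMv hu hv h1 h2 hφ hmax hκ hδ
  have hpos : ∀ᶠ δ : ℝ in 𝓝[>] 0, 0 < δ := self_mem_nhdsWithin
  have hid : Tendsto (fun δ : ℝ => δ) (𝓝[>] 0) (𝓝 0) := tendsto_id.mono_left nhdsWithin_le_nhds
  have hxlim : Tendsto x (𝓝[>] 0) (𝓝 x₀) := by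
    rw [tendsto_iff_norm_sub_tendsto_zero]
    have h3 : Tendsto (fun δ : ℝ => √((L : ℝ) ^ 2 * δ)) (𝓝[>] 0) (𝓝 0) := by
      have := (hid.const_mul ((L : ℝ) ^ 2)).sqrt
      rwa [mul_zero, Real.sqrt_zero] at this
    refine squeeze_zero' (Eventually.of_forall fun δ => norm_nonneg _) ?_ h3
    filter_upwards [hpos] with δ hδ
    exact Real.le_sqrt_of_sq_le (hx δ hδ)
  have hylim : Tendsto y (𝓝[>] 0) (𝓝 x₀) := by
    have h3 : Tendsto (fun δ => x δ - y δ) (𝓝[>] 0) (𝓝 0) := by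
      have h4 : Tendsto (fun δ : ℝ => (L : ℝ) * δ ^ 2) (𝓝[>] 0) (𝓝 0) := by
        simpa using (hid.pow 2).const_mul (L : ℝ)
      refine squeeze_zero_norm' ?_ h4
      filter_upwards [hpos] with δ hδ using hxy δ hδ
    simpa using hxlim.sub h3
  have hout : ∀ {w : Rn n → ℝ} {z : ℝ → Rn n}, Continuous w → (∀ x, |w x| ≤ M) →
      Tendsto z (𝓝[>] 0) (𝓝 x₀) →
      Tendsto (fun δ => outerHalfLap κ w (z δ)) (𝓝[>] 0) (𝓝 (outerHalfLap κ w x₀)) :=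
    fun hw hMw hz =>
      ((tendsto_setIntegral_compl_ball hn hκ.1 hw hMw x₀).comp hz).const_mul (-halfLapConst n)
  have hlhs : Tendsto (fun δ => -halfLapConst n *
        (taylorIntegral κ φ (x δ) + δ * sqIntegral n κ + 2 * δ)
        + (outerHalfLap κ u (x δ) - outerHalfLap κ v (y δ))) (𝓝[>] 0)
      (𝓝 (-halfLapConst n * (taylorIntegral κ φ x₀ + 0 * sqIntegral n κ + 2 * 0)
        + (outerHalfLap κ u x₀ - outerHalfLap κ v x₀))) :=
    (((((tendsto_taylorIntegral hn hφ κ x₀).comp hxlim).add (hid.mul_const _)).add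
      (hid.const_mul 2)).const_mul _).add
      ((hout hu hMu hxlim).sub (hout hv.continuous hMv hylim))
  have hrhs : Tendsto (fun δ => C * (1 + M + 2 * L) * (L * δ ^ 2 + d)
        + B * |u (x δ) - v (y δ)| + A * ‖gradient φ (x δ) + (2 * δ) • (x δ - x₀)‖) (𝓝[>] 0)
      (𝓝 (C * (1 + M + 2 * L) * (L * 0 ^ 2 + d) + B * |u x₀ - v x₀|
        + A * ‖gradient φ x₀ + (2 * (0 : ℝ)) • (x₀ - x₀)‖)) :=
    (((((hid.pow 2).const_mul _).add_const d).const_mul _).add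
      ((((hu.tendsto x₀).comp hxlim).sub ((hv.continuous.tendsto x₀).comp hylim)).abs.const_mul
        B)).add
      (((((continuous_gradient hφ).tendsto x₀).comp hxlim).add
        ((hid.const_mul 2).smul (hxlim.sub_const x₀))).norm.const_mul A)
  have hlim := le_of_tendsto_of_tendsto hlhs hrhs (hpos.mono fun δ hδ => hest δ hδ)
  have hw : outerHalfLap κ (fun x => u x - v x) x₀
      = outerHalfLap κ u x₀ - outerHalfLap κ v x₀ := by
    unfold outerHalfLap
    rw [← mul_sub, ← integral_sub (integrableOn_compl_ball_diff hn hκ.1 hu hMu x₀)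
      (integrableOn_compl_ball_diff hn hκ.1 hv.continuous hMv x₀)]
    congr 1
    refine integral_congr_ae (Eventually.of_forall fun z => ?_)
    simp only
    ring
  unfold lowerExtremal
  rw [innerHalfLap_eq hn hφ, hw]
  rw [sub_self, smul_zero, add_zero] at hlim
  have h3 : B * |u x₀ - v x₀| ≤ B * S := by gcongr; exact hS x₀
  have h4 : lam * (u x₀ - v x₀) ≤ lam * S := by
    gcongr; exact (le_abs_self _).trans (hS x₀)
  linarith

theorem outerHalfLap_neg (κ : ℝ) (u : Rn n → ℝ) (x : Rn n) :
    outerHalfLap κ (fun y => -u y) x = -outerHalfLap κ u x := by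
  unfold outerHalfLap
  rw [← mul_neg, ← integral_neg]
  congr 1
  refine integral_congr_ae (Eventually.of_forall fun z => ?_)
  simp only
  ring

/-- The two extremal inequalities are exchanged by a change of sign. -/
theorem IsViscositySubsolution.neg_lowerExtremal (hn : 1 ≤ n) {A B lam : ℝ} {w : Rn n → ℝ}
    (h : IsViscositySubsolution (lowerExtremal A B lam) w) (hw : Continuous w) :
    IsViscositySupersolution (upperExtremal A B lam) (fun x => -w x) := by
  obtain ⟨-, ⟨C, hC⟩, h⟩ := h
  refine ⟨hw.neg.lowerSemicontinuous, ⟨C, fun x => by simpa using hC x⟩, ?_⟩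
  intro φ hφ x hmin κ hκ
  have := h (fun y => -φ y) hφ.neg x (fun y => by linarith [hmin y]) κ hκ
  rw [innerHalfLap_eq hn hφ.neg, taylorIntegral_neg, gradient_neg] at this
  rw [innerHalfLap_eq hn hφ, outerHalfLap_neg]
  unfold lowerExtremal at this
  unfold upperExtremal
  rw [norm_neg] at this
  linarith

end Doubling

/-! ### Translations and the Isaacs equation -/

section Translation

variable {n : ℕ}

theorem gradient_comp_sub (φ : Rn n → ℝ) (ℓ x : Rn n) :
    gradient (fun y => φ (y - ℓ)) (x + ℓ) = gradient φ x := by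
  rw [gradient, fderiv_comp_sub, add_sub_cancel_right]
  rfl

theorem innerHalfLap_comp_sub (κ : ℝ) (φ : Rn n → ℝ) (ℓ x : Rn n) :
    innerHalfLap κ (fun y => φ (y - ℓ)) (x + ℓ) = innerHalfLap κ φ x := by
  simp only [innerHalfLap, add_right_comm x ℓ, add_sub_cancel_right]

theorem outerHalfLap_comp_add (κ : ℝ) (u : Rn n → ℝ) (ℓ x : Rn n) :
    outerHalfLap κ (fun y => u (y + ℓ)) x = outerHalfLap κ u (x + ℓ) := by
  simp only [outerHalfLap, add_right_comm x ℓ]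

variable {𝒜 ℬ : Type*} {D : IsaacsCoeff n 𝒜 ℬ}

theorem IsViscositySubsolution.translate {u : Rn n → ℝ} (h : IsViscositySubsolution D.op u)
    (hu : Continuous u) (ℓ : Rn n) :
    IsViscositySubsolution (D.shiftedOp ℓ) (fun x => u (x + ℓ)) := by
  obtain ⟨-, ⟨C, hC⟩, h⟩ := h
  refine ⟨(hu.comp (continuous_add_const ℓ)).upperSemicontinuous, ⟨C, fun x => hC _⟩, ?_⟩
  intro φ hφ x hmax κ hκ
  have := h (fun y => φ (y - ℓ)) (hφ.comp (contDiff_id.sub contDiff_const)) (x + ℓ)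
    (fun y => by simpa using hmax (y - ℓ)) κ hκ
  rwa [gradient_comp_sub, innerHalfLap_comp_sub, ← outerHalfLap_comp_add] at this

theorem IsViscositySupersolution.translate {u : Rn n → ℝ} (h : IsViscositySupersolution D.op u)
    (hu : Continuous u) (ℓ : Rn n) :
    IsViscositySupersolution (D.shiftedOp ℓ) (fun x => u (x + ℓ)) := by
  obtain ⟨-, ⟨C, hC⟩, h⟩ := h
  refine ⟨(hu.comp (continuous_add_const ℓ)).lowerSemicontinuous, ⟨C, fun x => hC _⟩, ?_⟩
  intro φ hφ x hmin κ hκ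
  have := h (fun y => φ (y - ℓ)) (hφ.comp (contDiff_id.sub contDiff_const)) (x + ℓ)
    (fun y => by simpa using hmin (y - ℓ)) κ hκ
  rwa [gradient_comp_sub, innerHalfLap_comp_sub, ← outerHalfLap_comp_add] at this

end Translation

namespace IsaacsCoeff

variable {n : ℕ} {𝒜 ℬ : Type*} [Nonempty 𝒜] [Nonempty ℬ] {D : IsaacsCoeff n 𝒜 ℬ} {K lam₁ : ℝ}

theorem Bounds.K_pos (h : D.Bounds K lam₁) : 0 < K := by
  obtain ⟨α⟩ := ‹Nonempty 𝒜›
  obtain ⟨β⟩ := ‹Nonempty ℬ›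
  exact h.pos.trans ((h.a_gt α β 0).trans_le ((le_abs_self _).trans (h.a_le α β 0)))

/-- The difference of a subsolution of the shifted equation and a supersolution of the equation,
with any bound `S` on it in the place of the supremum of `|u(x+ℓ) - v(x)|`. -/
theorem Bounds.isViscositySubsolution_sub (hn : 1 ≤ n) (h : D.Bounds K lam₁) {lam : ℝ}
    (hlam : 0 ≤ lam) {M L : ℝ≥0} {u v : Rn n → ℝ} (hMu : ∀ x, |u x| ≤ M) (hMv : ∀ x, |v x| ≤ M)
    (hu : Continuous u) (hv : LipschitzWith L v) {S : ℝ} (hS : ∀ x, |u x - v x| ≤ S) (ℓ : Rn n)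
    (h1 : IsViscositySubsolution (D.shiftedOp ℓ) u) (h2 : IsViscositySupersolution D.op v) :
    IsViscositySubsolution (lowerExtremal (K / lam₁) ((K / lam₁ + lam) * S
      + (K / lam₁ + K ^ 2 / lam₁ ^ 2) * (1 + M + 2 * L) * ‖ℓ‖) lam) (fun x => u x - v x) := by
  have hK := h.K_pos
  have hl := h.pos
  refine _root_.isViscositySubsolution_sub hn (by positivity) (by positivity)
    (norm_nonneg ℓ) hlam (fun x y r s p q t τ hx hy => (h.sub_le hx hy).trans ?_) hMu hMv hu hv hS
    h1 h2
  have h3 : ‖x + ℓ - y‖ ≤ ‖x - y‖ + ‖ℓ‖ := by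
    rw [add_sub_right_comm]; exact norm_add_le _ _
  gcongr

/-- As `IsaacsCoeff.Bounds.isViscositySubsolution_sub`, with the roles of the two equations
exchanged; the sign change reduces this to the comparison of `v` with `u`. -/
theorem Bounds.isViscositySupersolution_sub (hn : 1 ≤ n) (h : D.Bounds K lam₁) {lam : ℝ}
    (hlam : 0 ≤ lam) {M L : ℝ≥0} {u v : Rn n → ℝ} (hMu : ∀ x, |u x| ≤ M) (hMv : ∀ x, |v x| ≤ M)
    (hu : LipschitzWith L u) (hv : Continuous v) {S : ℝ} (hS : ∀ x, |u x - v x| ≤ S) (ℓ : Rn n)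
    (h1 : IsViscositySupersolution (D.shiftedOp ℓ) u) (h2 : IsViscositySubsolution D.op v) :
    IsViscositySupersolution (upperExtremal (K / lam₁) ((K / lam₁ + lam) * S
      + (K / lam₁ + K ^ 2 / lam₁ ^ 2) * (1 + M + 2 * L) * ‖ℓ‖) lam) (fun x => u x - v x) := by
  have hK := h.K_pos
  have hl := h.pos
  have key := _root_.isViscositySubsolution_sub (A := K / lam₁) (B := K / lam₁)
    (C := K / lam₁ + K ^ 2 / lam₁ ^ 2) hn (by positivity) (by positivity)
    (norm_nonneg ℓ) hlam
    (fun x y r s p q t τ hx hy => (h.sub_le hx hy).trans (by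
      have h3 : ‖x - (y + ℓ)‖ ≤ ‖x - y‖ + ‖ℓ‖ := by
        rw [← sub_sub]; exact norm_sub_le _ _
      gcongr)) hMv hMu hv hu (fun x => by rw [abs_sub_comm]; exact hS x) h2 h1
  simpa only [neg_sub] using key.neg_lowerExtremal hn (hv.sub hu.continuous)

end IsaacsCoeff

theorem abs_apply_add_sub_le {n : ℕ} {u : Rn n → ℝ} {L : ℝ≥0} (hu : LipschitzWith L u)
    (x ℓ : Rn n) : |u (x + ℓ) - u x| ≤ L * ‖ℓ‖ := by
  simpa [Real.dist_eq, dist_eq_norm] using hu.dist_le_mul (x + ℓ) x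

theorem lemma2p5 {n : ℕ} (hn : 1 ≤ n) {𝒜 ℬ : Type*}
    [MetricSpace 𝒜] [CompactSpace 𝒜] [Nonempty 𝒜]
    [MetricSpace ℬ] [CompactSpace ℬ] [Nonempty ℬ]
    (D : IsaacsCoeff n 𝒜 ℬ) (lam : ℝ) (hD : D.Admissible lam) :
    (∀ M L : ℝ≥0, ∃ A B₀ B₁ : ℝ, 0 < A ∧ 0 < B₀ ∧ 0 < B₁ ∧
      ∀ (ℓ : Rn n) (u v : Rn n → ℝ),
        (∀ x, |u x| ≤ M) → (∀ x, |v x| ≤ M) → LipschitzWith L u → LipschitzWith L v →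
        (IsViscositySubsolution (D.shiftedOp ℓ) u → IsViscositySupersolution D.op v →
          IsViscositySubsolution
            (lowerExtremal A (B₀ * (⨆ x, |u (x + ℓ) - v x|) + B₁ * ‖ℓ‖) lam)
            (fun x => u x - v x)) ∧
        (IsViscositySupersolution (D.shiftedOp ℓ) u → IsViscositySubsolution D.op v →
          IsViscositySupersolution
            (upperExtremal A (B₀ * (⨆ x, |u (x + ℓ) - v x|) + B₁ * ‖ℓ‖) lam)
            (fun x => u x - v x))) ∧
    (∀ u : Rn n → ℝ, IsViscositySolution D.op u → (∃ L : ℝ≥0, LipschitzWith L u) →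
      ∃ A B : ℝ, 0 < A ∧ 0 < B ∧ ∀ ℓ : Rn n,
        IsViscositySubsolution (lowerExtremal A (B * ‖ℓ‖) lam) (fun x => u (x + ℓ) - u x) ∧
        IsViscositySupersolution (upperExtremal A (B * ‖ℓ‖) lam) (fun x => u (x + ℓ) - u x)) := by
  obtain ⟨K, lam₁, h⟩ := hD.exists_bounds
  have hK := h.K_pos
  have hl := h.pos
  have hlam := hD.lam_pos
  refine ⟨fun M L => ⟨K / lam₁, K / lam₁ + lam, (K / lam₁ + lam) * L
    + (K / lam₁ + K ^ 2 / lam₁ ^ 2) * (1 + M + 2 * L), by positivity, by positivity,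
    by positivity, fun ℓ u v hMu hMv hu hv => ?_⟩, ?_⟩
  · have hbdd : BddAbove (Set.range fun x => |u (x + ℓ) - v x|) := by
      refine ⟨M + M, ?_⟩
      rintro _ ⟨x, rfl⟩
      exact (abs_sub _ _).trans (add_le_add (hMu _) (hMv _))
    -- Replacing `u(x+ℓ)` by `u(x)` costs `L |ℓ|`, which goes into the term with `B₁`.
    have hS : ∀ x, |u x - v x| ≤ (⨆ x, |u (x + ℓ) - v x|) + L * ‖ℓ‖ := fun x => by
      have h1 := le_ciSup hbdd x
      have h2 := abs_apply_add_sub_le hu x ℓ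
      rw [abs_sub_comm] at h2
      linarith [abs_sub_le (u x) (u (x + ℓ)) (v x)]
    have hconst : (K / lam₁ + lam) * (⨆ x, |u (x + ℓ) - v x|) + ((K / lam₁ + lam) * L
        + (K / lam₁ + K ^ 2 / lam₁ ^ 2) * (1 + M + 2 * L)) * ‖ℓ‖
        = (K / lam₁ + lam) * ((⨆ x, |u (x + ℓ) - v x|) + L * ‖ℓ‖)
        + (K / lam₁ + K ^ 2 / lam₁ ^ 2) * (1 + M + 2 * L) * ‖ℓ‖ := by ring
    rw [hconst]
    exact ⟨h.isViscositySubsolution_sub hn hlam.le hMu hMv hu.continuous hv hS ℓ,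
      h.isViscositySupersolution_sub hn hlam.le hMu hMv hu hv.continuous hS ℓ⟩
  · rintro u ⟨hsub, hsup⟩ ⟨L, hu⟩
    obtain ⟨C, hC⟩ := hsub.2.1
    lift C to ℝ≥0 using (abs_nonneg _).trans (hC 0)
    refine ⟨K / lam₁, (K / lam₁ + lam) * L + (K / lam₁ + K ^ 2 / lam₁ ^ 2) * (1 + C + 2 * L),
      by positivity, by positivity, fun ℓ => ?_⟩
    have hconst : ((K / lam₁ + lam) * L
        + (K / lam₁ + K ^ 2 / lam₁ ^ 2) * (1 + C + 2 * L)) * ‖ℓ‖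
        = (K / lam₁ + lam) * (L * ‖ℓ‖)
        + (K / lam₁ + K ^ 2 / lam₁ ^ 2) * (1 + C + 2 * L) * ‖ℓ‖ := by ring
    have hu' : LipschitzWith L fun x => u (x + ℓ) := 
      LipschitzWith.of_dist_le_mul fun x y => by simpa using hu.dist_le_mul (x + ℓ) (y + ℓ)
    have hS := fun x => abs_apply_add_sub_le hu x ℓ
    rw [hconst]
    exact ⟨h.isViscositySubsolution_sub hn hlam.le (fun x => hC _) hC hu'.continuous hu hS ℓ
        (hsub.translate hu.continuous ℓ) hsup,
      h.isViscositySupersolution_sub hn hlam.le (fun x => hC _) hC hu' hu.continuous hS ℓ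
        (hsup.translate hu.continuous ℓ) hsub⟩
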